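/- Let $m,n\ge 1$ be integers with $2m>n$, and put $\eta=m/n$, $r=\max(n-m,0)$, $k=\min(n,2m-n)$. A generalized singular value decomposition (GSVD) of $H_1,H_2\in\mathbb C^{m\times n}$ consists of unitary $U,V\in\mathbb C^{m\times m}$, a nonsingular $Q\in\mathbb C^{n\times n}$ and reals $1\ge\alpha_1\ge\dots\ge\alpha_k\ge 0$, $\beta_i\ge 0$ with $\alpha_i^2+\beta_i^2=1$ such that $UH_1Q=\Sigma_1$ and $VH_2Q=\Sigma_2$, where, with $S_1=\mathrm{diag}(\alpha_i)$ and $S_2=\mathrm{diag}(\beta_i)$, $$\Sigma_1=\begin{pmatrix}S_1\\O\end{pmatrix},\ \Sigma_2=\begin{pmatrix}O\\S_2\end{pmatrix}\ (m\ge n),\qquad \Sigma_1=\begin{pmatrix}I_r&O&O\\O&S_1&O\end{pmatrix},\ \Sigma_2=\begin{pmatrix}O&S_2&O\\O&O&I_r\end{pmatrix}\ (m<n<2m).$$ Write $H=\begin{pmatrix}H_1\\H_2\end{pmatrix}$. For every GSVD of any two matrices $H_1,H_2\in\mathbb C^{m\times n}$, the matrix $H^HH$ is invertible and $QQ^H=(H^HH)^{-1}$.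 Let now $H_1,H_2$ be random, with all $2mn$ entries i.i.d. circularly symmetric complex Gaussian of mean zero and unit variance, and let $U,V,Q,\alpha,\beta$ almost surely be a GSVD of $H_1,H_2$, with $Q$ a random matrix. Let the messages $s_{1i},s_{2i}$ ($1\le i\le n$) of the two users be i.i.d. circularly symmetric complex Gaussian of mean zero and unit variance, jointly independent of $(H_1,H_2,Q)$; let $d_1,d_2>0$, $\tau\in\mathbb R$ and $l_1>l_2$ with $l_1^2+l_2^2=1$. Define the transmitted vector $s\in\mathbb C^n$ by $s_i=s_{1i}$ for $i\le r$, $s_i=s_{2i}$ for $i>r+k$, and for $r<i\le r+k$ by $s_i=l_2s_{1i}+l_1s_{2i}$ if $\alpha_{i-r}/\sqrt{d_1^\tau}>\beta_{i-r}/\sqrt{d_2^\tau}$ and $s_i=l_1s_{1i}+l_2s_{2i}$ otherwise. Then all expectations below are finite, and the long-term power normalization factor $t^2=\mathbb E[\mathrm{trace}(Qss^HQ^H)]$ satisfies $$t^2=\mathbb E[\mathrm{trace}(QQ^H)]=\mathbb E[\mathrm{trace}((H^HH)^{-1})]=\frac1{2\eta-1}.$$ -/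

import Mathlib

open MeasureTheory ProbabilityTheory
open scoped Matrix NNReal

/-- The circularly symmetric complex Gaussian law `CN(0,1)` of mean zero and unit variance:
real and imaginary part are independent real Gaussians of mean `0` and variance `1/2`. -/
noncomputable def complexGaussian : Measure ℂ :=
  ((gaussianReal 0 (1 / 2)).prod (gaussianReal 0 (1 / 2))).map
    (fun p : ℝ × ℝ => (⟨p.1, p.2⟩ : ℂ))

/-- The family `X` consists of mutually independent random variables with law `CN(0,1)`. -/
structure IsIIDComplexGaussian {ι Ω : Type*} [MeasurableSpace Ω] (P : Measure Ω)
    (X : ι → Ω → ℂ) : Prop where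
  hasLaw : ∀ i, HasLaw (X i) complexGaussian P
  indep : iIndepFun X P

/-- `r = n - m` if `m < n`, and `r = 0` if `n ≤ m` (truncated subtraction). -/
abbrev gsvdShift (m n : ℕ) : ℕ := n - m

/-- The number of generalized singular values: `n` if `n ≤ m`, `2m - n` if `m < n < 2m`, and
`0` if `2m ≤ n` (truncated subtraction). -/
abbrev gsvdCount (m n : ℕ) : ℕ := min n (2 * m - n)

/-- The `m × n` matrix `Σ₁`. With `S₁ = diag α` it is
`[S₁; O]` if `n ≤ m`, `[[I_r, O, O], [O, S₁, O]]` if `m < n < 2m`, and `[I_m, O]` if `2m ≤ n`.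
In all cases only the entries `(j, j)` can be nonzero. -/
noncomputable def gsvdSigma₁ (m n : ℕ) (α : Fin (gsvdCount m n) → ℝ) :
    Matrix (Fin m) (Fin n) ℂ :=
  Matrix.of fun i j =>
    if (i : ℕ) = j then
      (if h : gsvdShift m n ≤ j ∧ (j : ℕ) - gsvdShift m n < gsvdCount m n then
        ((α ⟨(j : ℕ) - gsvdShift m n, h.2⟩ : ℝ) : ℂ) else 1)
    else 0

/-- The `m × n` matrix `Σ₂`. With `S₂ = diag β` it is
`[O; S₂]` if `n ≤ m`, `[[O, S₂, O], [O, O, I_r]]` if `m < n < 2m`, and `[O, I_m]` if `2m ≤ n`.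
In all cases only the entries `(i, j)` on the diagonal that ends in the lower right corner,
`m - i = n - j`, can be nonzero. -/
noncomputable def gsvdSigma₂ (m n : ℕ) (β : Fin (gsvdCount m n) → ℝ) :
    Matrix (Fin m) (Fin n) ℂ :=
  Matrix.of fun i j =>
    if (i : ℕ) + n = j + m then
      (if h : gsvdShift m n ≤ j ∧ (j : ℕ) - gsvdShift m n < gsvdCount m n then
        ((β ⟨(j : ℕ) - gsvdShift m n, h.2⟩ : ℝ) : ℂ) else 1)
    else 0

/-- `(U, V, Q, α, β)` is a generalized singular value decomposition of the `m × n` matrices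
`H₁` and `H₂`: `U H₁ Q = Σ₁` and `V H₂ Q = Σ₂` with `U`, `V` unitary, `Q` nonsingular, and
`Σ₁`, `Σ₂` built from `1 ≥ α₁ ≥ α₂ ≥ ⋯ ≥ 0` and `βᵢ ≥ 0` with `αᵢ² + βᵢ² = 1`. -/
structure IsGSVD {m n : ℕ} (H₁ H₂ : Matrix (Fin m) (Fin n) ℂ)
    (U V : Matrix (Fin m) (Fin m) ℂ) (Q : Matrix (Fin n) (Fin n) ℂ)
    (α β : Fin (gsvdCount m n) → ℝ) : Prop where
  unitary_left : U ∈ Matrix.unitaryGroup (Fin m) ℂ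
  unitary_right : V ∈ Matrix.unitaryGroup (Fin m) ℂ
  nonsingular : IsUnit Q.det
  alpha_nonneg : ∀ i, 0 ≤ α i
  alpha_le_one : ∀ i, α i ≤ 1
  alpha_antitone : Antitone α
  beta_nonneg : ∀ i, 0 ≤ β i
  sq_add_sq : ∀ i, α i ^ 2 + β i ^ 2 = 1
  eq_sigma₁ : U * H₁ * Q = gsvdSigma₁ m n α
  eq_sigma₂ : V * H₂ * Q = gsvdSigma₂ m n β

/-- The information bearing vector `s` for `n < 2m`, made from the messages `s₁`, `s₂` for the
two users. With `r = max (n - m) 0`: the first `r` entries carry only the message for user 1,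
the entries after position `min m n` only the message for user 2, and the entries in between are
superpositions with power coefficients `l₁`, `l₂`, the smaller one, `l₂`, going to the user with
the stronger subchannel (gains `α / √(d₁^τ)` and `β / √(d₂^τ)`). -/
noncomputable def nomaSymbol {m n : ℕ} (d₁ d₂ τ l₁ l₂ : ℝ)
    (α β : Fin (gsvdCount m n) → ℝ) (s₁ s₂ : Fin n → ℂ) : Fin n → ℂ := fun j =>
  if (j : ℕ) < gsvdShift m n then s₁ j
  else if h : (j : ℕ) - gsvdShift m n < gsvdCount m n then
    (if β ⟨(j : ℕ) - gsvdShift m n, h⟩ / √(d₂ ^ τ) < α ⟨(j : ℕ) - gsvdShift m n, h⟩ / √(d₁ ^ τ)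
      then l₂ * s₁ j + l₁ * s₂ j
      else l₁ * s₁ j + l₂ * s₂ j)
  else s₂ j

/-- The squared long-term power normalization factor `t² = E[trace (Q s sᴴ Qᴴ)]`. -/
noncomputable def powerNormSq {n : ℕ} {Ω : Type*} [MeasurableSpace Ω] (P : Measure Ω)
    (Q : Ω → Matrix (Fin n) (Fin n) ℂ) (s : Ω → Fin n → ℂ) : ℂ :=
  ∫ ω, (Q ω * Matrix.vecMulVec (s ω) (star (s ω)) * (Q ω)ᴴ).trace ∂P

/-! The formula rests on an algebraic identity, an average over the messages and an average over the
channel.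

Algebra: left multiplication by a unitary preserves Gram matrices, and for `n < 2 * m` the Gram
matrices of Σ₁ and Σ₂ add up to I. Hence Qᴴ(HᴴH)Q = I, which gives both the invertibility of HᴴH and
QQᴴ = (HᴴH)⁻¹ (`IsGSVD.gram_mul_mul_conjTranspose`).

Messages: s is a matrix C applied to the stacked messages, and CCᴴ = I because the squared
amplitudes sum to 1 in every coordinate (`nomaMatrix_mul_conjTranspose`). The values α, β, hence C,
are almost surely functions of (H₁, H₂, Q), so QC is independent of the messages. Averaging over
these replaces ssᴴ by the identity (`integrable_and_integral_trace_mul_vecMulVec`).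

Channel: the j-th diagonal entry of (HᴴH)⁻¹ is 1/‖Bh‖², with h the j-th column of H and the rows of
B an orthonormal basis of the complement of the other n - 1 columns
(`inv_gram_apply_mul_sum_normSq`). Given those columns, ‖Bh‖² has Laplace transform (1+t)^(-D) with
D = 2m - n + 1. Integrating it over t > 0 gives E[1/‖Bh‖²] = 1/(D - 1) = 1/(2m - n), and n such
entries sum to 1/(2η - 1) (`integrable_and_integral_trace_inv_gram`). -/

/-! ### Moments and transforms of CN(0,1). -/

theorem integral_complexGaussian_eq {E : Type*} [NormedAddCommGroup E] [NormedSpace ℝ E]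
    (f : ℂ → E) :
    ∫ z, f z ∂complexGaussian =
      ∫ p : ℝ × ℝ, f ⟨p.1, p.2⟩ ∂((gaussianReal 0 (1 / 2)).prod (gaussianReal 0 (1 / 2))) :=
  integral_map_equiv Complex.measurableEquivRealProd.symm f

instance : IsProbabilityMeasure complexGaussian :=
  Measure.isProbabilityMeasure_map Complex.measurableEquivRealProd.symm.measurable.aemeasurable

/-- Reduces moments and transforms to one real variable. Integrals of products over a product
measure factor unconditionally, so no integrability is required. -/
theorem integral_complexGaussian_re_mul_im {𝕜 : Type*} [RCLike 𝕜] (g h : ℝ → 𝕜) :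
    ∫ z, g z.re * h z.im ∂complexGaussian =
      (∫ x, g x ∂gaussianReal 0 (1 / 2)) * ∫ x, h x ∂gaussianReal 0 (1 / 2) := by
  rw [integral_complexGaussian_eq]
  exact integral_prod_mul g h

theorem measurePreserving_re_complexGaussian :
    MeasurePreserving Complex.re complexGaussian (gaussianReal 0 (1 / 2)) := by
  refine ⟨Complex.measurable_re, ?_⟩
  have h : Measurable fun p : ℝ × ℝ => (⟨p.1, p.2⟩ : ℂ) :=
    Complex.measurableEquivRealProd.symm.measurable
  rw [complexGaussian, Measure.map_map Complex.measurable_re h]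
  exact measurePreserving_fst.map_eq

theorem measurePreserving_im_complexGaussian :
    MeasurePreserving Complex.im complexGaussian (gaussianReal 0 (1 / 2)) := by
  refine ⟨Complex.measurable_im, ?_⟩
  have h : Measurable fun p : ℝ × ℝ => (⟨p.1, p.2⟩ : ℂ) :=
    Complex.measurableEquivRealProd.symm.measurable
  rw [complexGaussian, Measure.map_map Complex.measurable_im h]
  exact measurePreserving_snd.map_eq

theorem memLp_two_id_complexGaussian : MemLp id 2 complexGaussian := by
  have hre : MemLp (fun z : ℂ => (z.re : ℂ)) 2 complexGaussian :=
    ((memLp_id_gaussianReal 2).comp_measurePreserving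
      measurePreserving_re_complexGaussian).ofReal
  have him : MemLp (fun z : ℂ => (z.im : ℂ)) 2 complexGaussian :=
    ((memLp_id_gaussianReal 2).comp_measurePreserving
      measurePreserving_im_complexGaussian).ofReal
  refine (hre.add (him.mul_const Complex.I)).ae_eq (.of_forall fun z => ?_)
  exact Complex.re_add_im z

theorem integral_id_complexGaussian : ∫ z, z ∂complexGaussian = 0 := by
  have hint : Integrable (fun z : ℂ => z) complexGaussian :=
    memLp_two_id_complexGaussian.integrable one_le_two
  have hre : ∫ z, z.re ∂complexGaussian = 0 := by
    have := integral_complexGaussian_re_mul_im (𝕜 := ℝ) (fun x => x) (fun _ => 1)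
    simpa using this
  have him : ∫ z, z.im ∂complexGaussian = 0 := by
    have := integral_complexGaussian_re_mul_im (𝕜 := ℝ) (fun _ => 1) (fun x => x)
    simpa using this
  apply Complex.ext
  · have := integral_re hint
    simpa [hre] using this.symm
  · have := integral_im hint
    simpa [him] using this.symm

theorem integral_sq_gaussianReal_half : ∫ x, x ^ 2 ∂gaussianReal 0 (1 / 2) = 1 / 2 := by
  have h := variance_fun_id_gaussianReal (μ := 0) (v := 1 / 2)
  rw [variance_of_integral_eq_zero (by fun_prop) (by simp)] at h
  simpa using h

theorem integral_normSq_complexGaussian :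
    ∫ z : ℂ, z * star z ∂complexGaussian = 1 := by
  have h1 := integral_complexGaussian_re_mul_im (𝕜 := ℝ) (fun x => x ^ 2) (fun _ => 1)
  have h2 := integral_complexGaussian_re_mul_im (𝕜 := ℝ) (fun _ => 1) (fun x => x ^ 2)
  simp only [mul_one, one_mul, integral_sq_gaussianReal_half, integral_const, probReal_univ,
    smul_eq_mul] at h1 h2
  have i1 : Integrable (fun z : ℂ => z.re ^ 2) complexGaussian :=
    ((memLp_id_gaussianReal 2).comp_measurePreserving
      measurePreserving_re_complexGaussian).integrable_sq
  have i2 : Integrable (fun z : ℂ => z.im ^ 2) complexGaussian :=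
    ((memLp_id_gaussianReal 2).comp_measurePreserving
      measurePreserving_im_complexGaussian).integrable_sq
  have : ∀ z : ℂ, z * star z = ((z.re ^ 2 + z.im ^ 2 : ℝ) : ℂ) := fun z => by
    rw [Complex.star_def, Complex.mul_conj, Complex.normSq_apply]; congr 1; ring
  simp_rw [this]
  rw [integral_complex_ofReal, integral_add i1 i2, h1, h2]
  norm_num

/-- No sign condition on t is needed: for t ≤ -1 the integrand is not integrable and both sides are
0 by convention. -/
theorem integral_exp_neg_mul_sq_gaussianReal_half {t : ℝ} :
    ∫ x, Real.exp (-t * x ^ 2) ∂gaussianReal 0 (1 / 2) = √(1 / (1 + t)) := by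
  rw [integral_gaussianReal_eq_integral_smul (by norm_num)]
  have : ∀ x : ℝ, gaussianPDFReal 0 (1 / 2) x • Real.exp (-t * x ^ 2) =
      (√Real.pi)⁻¹ * Real.exp (-(1 + t) * x ^ 2) := fun x => by
    rw [gaussianPDFReal, smul_eq_mul, mul_assoc, ← Real.exp_add]
    have h2 : (2 : ℝ) * ((1 / 2 : ℝ≥0) : ℝ) = 1 := by norm_num
    rw [mul_right_comm, h2]
    ring_nf
  simp_rw [this]
  rw [integral_const_mul, integral_gaussian, ← Real.sqrt_inv, ← Real.sqrt_mul (by positivity)]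
  congr 1
  field_simp

theorem integral_exp_neg_mul_normSq_complexGaussian {t : ℝ} (ht : 0 ≤ t) :
    ∫ z : ℂ, Real.exp (-t * ‖z‖ ^ 2) ∂complexGaussian = (1 + t)⁻¹ := by
  have h := integral_complexGaussian_re_mul_im (𝕜 := ℝ) (fun x => Real.exp (-t * x ^ 2))
    (fun x => Real.exp (-t * x ^ 2))
  rw [integral_exp_neg_mul_sq_gaussianReal_half, Real.mul_self_sqrt (by positivity)] at h
  rw [← one_div, ← h]
  congr with z
  rw [← Real.exp_add, ← Complex.normSq_eq_norm_sq, Complex.normSq_apply]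
  ring_nf

/-- The characteristic function of `CN(0,1)`. -/
theorem integral_cexp_re_mul_complexGaussian (w : ℂ) :
    ∫ z : ℂ, Complex.exp (((star w * z).re : ℝ) * Complex.I) ∂complexGaussian =
      (Real.exp (-(1 / 4) * ‖w‖ ^ 2) : ℝ) := by
  have h := integral_complexGaussian_re_mul_im (𝕜 := ℂ)
    (fun x => Complex.exp (w.re * x * Complex.I)) (fun x => Complex.exp (w.im * x * Complex.I))
  -- Each factor is a real Gaussian characteristic function; the variance 1/2 produces the constant
  -- 1/4.
  rw [← charFun_apply_real, ← charFun_apply_real, charFun_gaussianReal, charFun_gaussianReal,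
    ← Complex.exp_add] at h
  have e : ∀ z : ℂ, Complex.exp (((star w * z).re : ℝ) * Complex.I) =
      Complex.exp (w.re * z.re * Complex.I) * Complex.exp (w.im * z.im * Complex.I) := fun z => by
    rw [← Complex.exp_add]
    simp [Complex.mul_re]
    ring_nf
  simp_rw [e]
  rw [h, ← Complex.normSq_eq_norm_sq, Complex.normSq_apply]
  push_cast
  congr 1
  ring

/-! ### Complex Gaussian vectors and their coisometric images. -/

theorem ofReal_sum_norm_sq_eq_dotProduct {ι : Type*} [Fintype ι] (w : ι → ℂ) :
    ((∑ i, ‖w i‖ ^ 2 : ℝ) : ℂ) = star w ⬝ᵥ w := by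
  simp [dotProduct, Complex.conj_mul']

theorem integral_exp_neg_mul_sum_normSq_pi {ι : Type*} [Fintype ι] {t : ℝ} (ht : 0 ≤ t) :
    ∫ z : ι → ℂ, Real.exp (-t * ∑ i, ‖z i‖ ^ 2) ∂Measure.pi (fun _ => complexGaussian) =
      ((1 + t) ^ Fintype.card ι)⁻¹ := by
  simp_rw [Finset.mul_sum, Real.exp_sum]
  rw [integral_fintype_prod_eq_pow (ι := ι) (fun z : ℂ => Real.exp (-t * ‖z‖ ^ 2)),
    integral_exp_neg_mul_normSq_complexGaussian ht, inv_pow]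

theorem integral_cexp_re_dotProduct_pi {ι : Type*} [Fintype ι] (w : ι → ℂ) :
    ∫ z : ι → ℂ, Complex.exp (((star w ⬝ᵥ z).re : ℝ) * Complex.I)
        ∂Measure.pi (fun _ => complexGaussian) =
      (Real.exp (-(1 / 4) * ∑ i, ‖w i‖ ^ 2) : ℝ) := by
  have e : ∀ z : ι → ℂ, Complex.exp (((star w ⬝ᵥ z).re : ℝ) * Complex.I) =
      ∏ i, Complex.exp (((star (w i) * z i).re : ℝ) * Complex.I) := fun z => by
    rw [← Complex.exp_sum, ← Finset.sum_mul, dotProduct, Complex.re_sum]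
    push_cast
    rfl
  simp_rw [e]
  rw [integral_fintype_prod_eq_prod (𝕜 := ℂ) (fun i (z : ℂ) =>
    Complex.exp (((star (w i) * z).re : ℝ) * Complex.I))]
  simp_rw [integral_cexp_re_mul_complexGaussian]
  rw [Finset.mul_sum, Real.exp_sum]
  push_cast
  rfl

/-- A complex Gaussian vector mapped by a coisometry of rank `d` has the Laplace transform of the
squared norm of a standard complex Gaussian vector in `d` dimensions. -/
theorem integral_exp_neg_mul_sum_normSq_mulVec {ι κ : Type*} [Fintype ι] [Fintype κ]
    [DecidableEq κ] (B : Matrix κ ι ℂ) (hB : B * Bᴴ = 1) {t : ℝ} (ht : 0 ≤ t) :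
    ∫ h : ι → ℂ, Real.exp (-t * ∑ k, ‖(B *ᵥ h) k‖ ^ 2) ∂Measure.pi (fun _ => complexGaussian) =
      ((1 + t) ^ Fintype.card κ)⁻¹ := by
  -- Linearisation of the square: exp(-t‖Bh‖²) is the characteristic function of an auxiliary
  -- Gaussian z at c·Bh, since c²/4 = t. After exchanging the integrals, B moves onto z as Bᴴ, which
  -- is isometric because BBᴴ = 1; integrating out h leaves exp(-t‖z‖²).
  set c : ℝ := 2 * √t
  have hc : c ^ 2 = 4 * t := by rw [mul_pow, Real.sq_sqrt ht]; norm_num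
  have h1 : ∀ h : ι → ℂ, ((Real.exp (-t * ∑ k, ‖(B *ᵥ h) k‖ ^ 2) : ℝ) : ℂ) =
      ∫ z : κ → ℂ, Complex.exp (((star ((c : ℂ) • (B *ᵥ h)) ⬝ᵥ z).re : ℝ) * Complex.I)
        ∂Measure.pi (fun _ => complexGaussian) := fun h => by
    rw [integral_cexp_re_dotProduct_pi]
    simp only [Pi.smul_apply, norm_smul, mul_pow, ← Finset.mul_sum, Complex.norm_real,
      Real.norm_eq_abs, sq_abs, hc]
    ring_nf
  have h2 : ∀ (h : ι → ℂ) (z : κ → ℂ), (star ((c : ℂ) • (B *ᵥ h)) ⬝ᵥ z).re =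
      (star ((c : ℂ) • (Bᴴ *ᵥ z)) ⬝ᵥ h).re := fun h z => by
    rw [← Complex.conj_re, ← Complex.star_def, Matrix.star_dotProduct, star_star]
    rw [star_smul, smul_dotProduct, dotProduct_smul, Matrix.star_mulVec,
      Matrix.conjTranspose_conjTranspose, Matrix.dotProduct_mulVec]
    simp
  have h3 : ∀ z : κ → ℂ, ∑ i, ‖((c : ℂ) • (Bᴴ *ᵥ z)) i‖ ^ 2 = 4 * t * ∑ k, ‖z k‖ ^ 2 := by
    intro z
    simp only [Pi.smul_apply, norm_smul, mul_pow, ← Finset.mul_sum, Complex.norm_real,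
      Real.norm_eq_abs, sq_abs, hc]
    congr 1
    apply Complex.ofReal_injective
    rw [ofReal_sum_norm_sq_eq_dotProduct, ofReal_sum_norm_sq_eq_dotProduct, Matrix.star_mulVec,
      Matrix.conjTranspose_conjTranspose, Matrix.dotProduct_mulVec, Matrix.vecMul_vecMul, hB,
      Matrix.vecMul_one]
  apply Complex.ofReal_injective
  rw [← integral_complex_ofReal]
  simp_rw [h1]
  rw [integral_integral_swap]
  · simp_rw [h2, integral_cexp_re_dotProduct_pi, h3]
    rw [integral_complex_ofReal, ← integral_exp_neg_mul_sum_normSq_pi ht]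
    congr 2 with z
    ring_nf
  · refine Integrable.of_bound (C := 1) (Continuous.aestronglyMeasurable ?_) (.of_forall ?_)
    · simp only [dotProduct, Matrix.mulVec, Function.uncurry_def, Pi.star_apply, Pi.smul_apply]
      fun_prop
    · intro p
      exact (Complex.norm_exp_ofReal_mul_I _).le

/-! ### Inverse moments from Laplace transforms. -/

/-- Working in `ENNReal` covers x = 0, where both sides are ∞, so zeros of the squared norm need no
separate treatment. -/
theorem lintegral_Ioi_ofReal_exp_neg_mul {x : ℝ} (hx : 0 ≤ x) :
    ∫⁻ t in Set.Ioi (0 : ℝ), ENNReal.ofReal (Real.exp (-t * x)) = (ENNReal.ofReal x)⁻¹ := by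
  rcases hx.eq_or_lt with rfl | hx
  · simp
  · have e : ∀ t : ℝ, -t * x = (-x) * t := fun t => by ring
    simp_rw [e]
    rw [← ofReal_integral_eq_lintegral_ofReal, integral_exp_mul_Ioi (by simpa)]
    · simp [ENNReal.ofReal_inv_of_pos hx]
    · exact integrableOn_exp_mul_Ioi (by simpa) 0
    · exact .of_forall fun t => (Real.exp_pos _).le

theorem lintegral_Ioi_ofReal_inv_one_add_pow (d : ℕ) :
    ∫⁻ t in Set.Ioi (0 : ℝ), ENNReal.ofReal ((1 + t) ^ (d + 2))⁻¹ =
      ENNReal.ofReal (1 / (d + 1)) := by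
  have hder : ∀ t ∈ Set.Ici (0 : ℝ), HasDerivAt
      (fun t : ℝ => -(1 / ((d : ℝ) + 1)) * ((1 + t) ^ (d + 1))⁻¹) (((1 + t) ^ (d + 2))⁻¹) t := by
    intro t ht
    have ht' : (1 + t) ≠ 0 := by have : (0 : ℝ) ≤ t := ht; positivity
    have := ((((hasDerivAt_id t).const_add 1).pow (d + 1)).inv (pow_ne_zero _ ht')).const_mul
      (-(1 / ((d : ℝ) + 1)))
    convert! this using 1
    have : (d : ℝ) + 1 ≠ 0 := by positivity
    simp
    field_simp
    ring
  have hlim : Filter.Tendsto (fun t : ℝ => -(1 / ((d : ℝ) + 1)) * ((1 + t) ^ (d + 1))⁻¹)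
      Filter.atTop (nhds 0) := by
    rw [← mul_zero (-(1 / ((d : ℝ) + 1)))]
    refine (Filter.Tendsto.inv_tendsto_atTop ?_).const_mul _
    exact (Filter.tendsto_pow_atTop (by simp)).comp
      (Filter.tendsto_atTop_add_const_left _ 1 Filter.tendsto_id)
  have hnn : ∀ t ∈ Set.Ioi (0 : ℝ), 0 ≤ ((1 + t) ^ (d + 2))⁻¹ := fun t ht => by
    have : (0 : ℝ) < t := ht
    positivity
  have hint := integrableOn_Ioi_deriv_of_nonneg' hder hnn hlim
  rw [← ofReal_integral_eq_lintegral_ofReal hint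
    ((ae_restrict_iff' measurableSet_Ioi).2 (.of_forall hnn)),
    integral_Ioi_of_hasDerivAt_of_nonneg' hder hnn hlim]
  simp

/-- The first inverse moment of the squared norm of a standard complex Gaussian vector in
`d ≥ 2` dimensions. -/
theorem lintegral_inv_sum_normSq_mulVec {ι κ : Type*} [Fintype ι] [Fintype κ]
    [DecidableEq κ] (B : Matrix κ ι ℂ) (hB : B * Bᴴ = 1) {d : ℕ} (hd : Fintype.card κ = d + 2) :
    ∫⁻ h : ι → ℂ, (ENNReal.ofReal (∑ k, ‖(B *ᵥ h) k‖ ^ 2))⁻¹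
      ∂Measure.pi (fun _ => complexGaussian) = ENNReal.ofReal (1 / (d + 1)) := by
  have hcont : Continuous fun p : (ι → ℂ) × ℝ =>
      Real.exp (-p.2 * ∑ k, ‖(B *ᵥ p.1) k‖ ^ 2) := by
    simp only [dotProduct, Matrix.mulVec]
    fun_prop
  -- Write 1/x as the integral of exp(-tx) over t > 0; Tonelli then needs only measurability.
  calc _ = ∫⁻ h : ι → ℂ, (∫⁻ t in Set.Ioi (0 : ℝ),
        ENNReal.ofReal (Real.exp (-t * ∑ k, ‖(B *ᵥ h) k‖ ^ 2)))
          ∂Measure.pi (fun _ => complexGaussian) := by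
        refine lintegral_congr fun h => ?_
        rw [lintegral_Ioi_ofReal_exp_neg_mul (by positivity)]
    _ = ∫⁻ t in Set.Ioi (0 : ℝ), ∫⁻ h : ι → ℂ,
        ENNReal.ofReal (Real.exp (-t * ∑ k, ‖(B *ᵥ h) k‖ ^ 2))
          ∂Measure.pi (fun _ => complexGaussian) :=
        lintegral_lintegral_swap hcont.measurable.ennreal_ofReal.aemeasurable
    _ = ∫⁻ t in Set.Ioi (0 : ℝ), ENNReal.ofReal ((1 + t) ^ (d + 2))⁻¹ := by
        refine setLIntegral_congr_fun measurableSet_Ioi fun t ht => ?_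
        have ht : (0 : ℝ) < t := ht
        rw [← ofReal_integral_eq_lintegral_ofReal,
          integral_exp_neg_mul_sum_normSq_mulVec B hB ht.le, hd]
        · refine Integrable.of_bound (C := 1) (Continuous.aestronglyMeasurable ?_)
            (.of_forall fun h => ?_)
          · exact hcont.comp (continuous_id.prodMk continuous_const)
          · rw [Real.norm_of_nonneg (Real.exp_pos _).le, Real.exp_le_one_iff, neg_mul,
              neg_nonpos]
            positivity
        · exact .of_forall fun h => (Real.exp_pos _).le
    _ = _ := lintegral_Ioi_ofReal_inv_one_add_pow d

/-! ### Inverse Gram matrices and distances to column spans. -/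

/-- The rows of `B` form an orthonormal basis of the orthogonal complement of the columns of
`A`. -/
structure IsColumnComplement {ι κ ν : Type*} [Fintype ι] [DecidableEq κ] [Fintype κ]
    (B : Matrix κ ι ℂ) (A : Matrix ι ν ℂ) : Prop where
  mul_conjTranspose : B * Bᴴ = 1
  mul_eq_zero : B * A = 0
  conjTranspose_mulVec_mulVec : ∀ y, Aᴴ *ᵥ y = 0 → Bᴴ *ᵥ (B *ᵥ y) = y

/-- The rows are conjugated orthonormal basis vectors of the complement, so that B computes inner
products with them. Linear independence fixes the number of rows, on which the inverse moment
depends. -/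
theorem exists_isColumnComplement {ι ν : Type*} [Fintype ι] [Fintype ν]
    (A : Matrix ι ν ℂ) (hA : LinearIndependent ℂ A.col) :
    ∃ B : Matrix (Fin (Fintype.card ι - Fintype.card ν)) ι ℂ, IsColumnComplement B A := by
  let a : ν → EuclideanSpace ℂ ι := fun j => WithLp.toLp 2 (A.col j)
  have ha : LinearIndependent ℂ a :=
    hA.map' (WithLp.linearEquiv 2 ℂ (ι → ℂ)).symm.toLinearMap (LinearEquiv.ker _)
  let V := Submodule.span ℂ (Set.range a)
  have hdim : Module.finrank ℂ Vᗮ = Fintype.card ι - Fintype.card ν := by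
    have h1 := V.finrank_add_finrank_orthogonal
    rw [finrank_span_eq_card ha, finrank_euclideanSpace] at h1
    omega
  let b := (stdOrthonormalBasis ℂ Vᗮ).reindex (finCongr hdim)
  have hb : ∀ k (y : EuclideanSpace ℂ ι), inner ℂ (b k : EuclideanSpace ℂ ι) y =
      ((Matrix.of fun k i => star ((b k : EuclideanSpace ℂ ι) i)) *ᵥ y.ofLp) k := fun k y => by
    simp [PiLp.inner_apply, Matrix.mulVec, dotProduct, mul_comm]
  refine ⟨Matrix.of fun k i => star ((b k : EuclideanSpace ℂ ι) i), ?_, ?_, ?_⟩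
  · ext k l
    have h1 := orthonormal_iff_ite.1 b.orthonormal k l
    rw [Submodule.coe_inner, hb] at h1
    rw [Matrix.one_apply, ← h1]
    simp [Matrix.mul_apply, Matrix.mulVec, dotProduct]
  · ext k j
    have h1 : inner ℂ (b k : EuclideanSpace ℂ ι) (a j) = 0 :=
      (Submodule.mem_orthogonal' _ _).1 (b k).2 _ (Submodule.subset_span ⟨j, rfl⟩)
    rw [hb] at h1
    exact h1
  · intro y hy
    have hyV : WithLp.toLp 2 y ∈ Vᗮ := by
      rw [Submodule.mem_orthogonal]
      intro u hu
      induction hu using Submodule.span_induction with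
      | mem x hx =>
        obtain ⟨j, rfl⟩ := hx
        have := congrFun hy j
        simpa [PiLp.inner_apply, Matrix.mulVec, dotProduct, mul_comm, a] using this
      | zero => simp
      | add x z _ _ hx hz => rw [inner_add_left, hx, hz, add_zero]
      | smul c x _ hx => rw [inner_smul_left, hx, mul_zero]
    have h1 := congrArg (fun x : Vᗮ => (x : EuclideanSpace ℂ ι).ofLp) (b.sum_repr' ⟨_, hyV⟩)
    simp only [Submodule.coe_inner, hb, Submodule.coe_sum, Submodule.coe_smul] at h1
    ext i
    rw [← congrFun h1 i]
    simp only [Matrix.mulVec, dotProduct, Matrix.conjTranspose_apply, Matrix.of_apply, star_star,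
      WithLp.ofLp_sum, WithLp.ofLp_smul, Finset.sum_apply, Pi.smul_apply, smul_eq_mul]
    exact Finset.sum_congr rfl fun _ _ => mul_comm _ _

theorem linearIndependent_col_of_isUnit_det_gram {ι ν : Type*} [Fintype ι] [Fintype ν]
    [DecidableEq ν] {H : Matrix ι ν ℂ} (hH : IsUnit (Hᴴ * H).det) :
    LinearIndependent ℂ H.col := by
  rw [← Matrix.mulVec_injective_iff]
  intro x y hxy
  apply Matrix.mulVec_injective_of_isUnit ((Matrix.isUnit_iff_isUnit_det _).2 hH)
  simp only [← Matrix.mulVec_mulVec]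
  exact congrArg _ hxy

/-- The diagonal entries of the inverse Gram matrix are the inverse squared distances of the
columns to the span of the others. -/
theorem inv_gram_apply_mul_sum_normSq {ι κ ν : Type*} [Fintype ι] [Fintype κ] [DecidableEq κ]
    [Fintype ν] [DecidableEq ν] {H : Matrix ι ν ℂ} (hH : IsUnit (Hᴴ * H).det) (j : ν)
    {B : Matrix κ ι ℂ}
    (hB : IsColumnComplement B (H.submatrix id (Subtype.val : {k // k ≠ j} → ν))) :
    (Hᴴ * H)⁻¹ j j * ((∑ k, ‖(B *ᵥ H.col j) k‖ ^ 2 : ℝ) : ℂ) = 1 := by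
  set G := (Hᴴ * H)⁻¹ with hG
  have hHG : Hᴴ * (H * G) = 1 := by rw [← Matrix.mul_assoc, Matrix.mul_nonsing_inv _ hH]
  -- This is the dual vector of column j: orthogonal to the other columns and of inner product 1
  -- with column j. Thus BᴴBy = y, while By is G j j times B applied to column j; pairing y with
  -- column j gives the identity.
  set y := (H * G).col j with hy
  have hHy : ∀ k, star (H.col k) ⬝ᵥ y = if k = j then 1 else 0 := fun k => by
    have := congrFun (congrFun hHG k) j
    rwa [Matrix.one_apply] at this
  have hBH : ∀ k ≠ j, B *ᵥ H.col k = 0 := fun k hk => by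
    ext l
    exact congrFun (congrFun hB.mul_eq_zero l) ⟨k, hk⟩
  have hBy : B *ᵥ y = G j j • (B *ᵥ H.col j) := by
    have : y = ∑ k, G k j • H.col k := by
      ext i
      simp [hy, Matrix.mul_apply, mul_comm]
    rw [this, Matrix.mulVec_sum, Finset.sum_eq_single j]
    · rw [Matrix.mulVec_smul]
    · intro k _ hk
      rw [Matrix.mulVec_smul, hBH k hk, smul_zero]
    · simp
  have hBBy : Bᴴ *ᵥ (B *ᵥ y) = y := by
    apply hB.conjTranspose_mulVec_mulVec
    ext k
    exact (hHy k).trans (if_neg k.2)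
  have h1 := hHy j
  rw [if_pos rfl, ← hBBy, Matrix.dotProduct_mulVec, ← Matrix.star_mulVec, hBy,
    dotProduct_smul, smul_eq_mul] at h1
  rwa [ofReal_sum_norm_sq_eq_dotProduct]

/-! ### Measurability of matrix operations. -/

theorem Measurable.matrix_det {α ν : Type*} [MeasurableSpace α] [Fintype ν] [DecidableEq ν]
    {M : α → Matrix ν ν ℂ} (hM : ∀ i j, Measurable fun x => M x i j) :
    Measurable fun x => (M x).det := by
  simp only [Matrix.det_apply']
  fun_prop

theorem Measurable.matrix_mul_apply {α ι κ ν : Type*} [MeasurableSpace α] [Fintype κ]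
    {M : α → Matrix ι κ ℂ} {N : α → Matrix κ ν ℂ} (hM : ∀ i j, Measurable fun x => M x i j)
    (hN : ∀ i j, Measurable fun x => N x i j) (i : ι) (j : ν) :
    Measurable fun x => (M x * N x) i j := by
  simp only [Matrix.mul_apply]
  fun_prop

theorem Measurable.matrix_conjTranspose_apply {α ι ν : Type*} [MeasurableSpace α]
    {M : α → Matrix ι ν ℂ} (hM : ∀ i j, Measurable fun x => M x i j) (i : ν) (j : ι) :
    Measurable fun x => (M x)ᴴ i j := by
  simp only [Matrix.conjTranspose_apply]
  exact continuous_star.measurable.comp (hM j i)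

/-- The formula det⁻¹ times adjugate also holds at singular matrices, where both conventions give 0,
so no restriction to invertible matrices is needed. -/
theorem Measurable.matrix_inv_apply {α ν : Type*} [MeasurableSpace α] [Fintype ν] [DecidableEq ν]
    {M : α → Matrix ν ν ℂ} (hM : ∀ i j, Measurable fun x => M x i j) (i j : ν) :
    Measurable fun x => (M x)⁻¹ i j := by
  simp only [Matrix.inv_def, Ring.inverse_eq_inv', Matrix.smul_apply, smul_eq_mul,
    Matrix.adjugate_apply]
  refine (Measurable.matrix_det hM).inv.mul (Measurable.matrix_det fun k l => ?_)
  simp only [Matrix.updateRow_apply]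
  split_ifs
  · exact measurable_const
  · exact hM k l

/-! ### Mean of the inverse Gram matrix of a Gaussian matrix. -/

/-- The matrix with column `j` equal to `h` and the other columns given by `A`. -/
def Matrix.insertCol {ι ν : Type*} [DecidableEq ν] (j : ν) (h : ι → ℂ)
    (A : ι × {k // k ≠ j} → ℂ) : Matrix ι ν ℂ :=
  Matrix.of fun i k => if hk : k = j then h i else A (i, ⟨k, hk⟩)

theorem measurable_insertCol_apply {ι ν : Type*} [DecidableEq ν] (j : ν) (i : ι) (k : ν) :
    Measurable fun p : (ι × {k // k ≠ j} → ℂ) × (ι → ℂ) =>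
      Matrix.insertCol j p.2 p.1 i k := by
  by_cases hk : k = j
  · simp only [Matrix.insertCol, Matrix.of_apply, hk, dite_true]
    fun_prop
  · simp only [Matrix.insertCol, Matrix.of_apply, hk, dite_false]
    fun_prop

/-- Conditional form of the mean: B depends only on the frozen columns, so it is a constant matrix
applied to a standard Gaussian vector. -/
theorem lintegral_inv_gram_insertCol {ι ν : Type*} [Fintype ι] [Fintype ν] [DecidableEq ν]
    (hcard : Fintype.card ν < Fintype.card ι) (j : ν) (A : ι × {k // k ≠ j} → ℂ)
    (hA : ∀ᵐ h ∂Measure.pi (fun _ : ι => complexGaussian),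
      IsUnit ((Matrix.insertCol j h A)ᴴ * Matrix.insertCol j h A).det) :
    ∫⁻ h, ENNReal.ofReal
        (((Matrix.insertCol j h A)ᴴ * Matrix.insertCol j h A)⁻¹ j j).re
          ∂Measure.pi (fun _ : ι => complexGaussian) =
      ENNReal.ofReal (1 / ((Fintype.card ι : ℝ) - Fintype.card ν)) := by
  let A' : Matrix ι {k // k ≠ j} ℂ := Matrix.of fun i k => A (i, k)
  have hsub : ∀ h, (Matrix.insertCol j h A).submatrix id (Subtype.val : {k // k ≠ j} → ν) = A' :=
    fun h => by
      ext i k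
      simp [Matrix.insertCol, A', k.2]
  have hcol : ∀ h, (Matrix.insertCol j h A).col j = h := fun h => by
    ext i
    simp [Matrix.insertCol]
  -- A single good choice of column j suffices: it forces independence of the other columns, which
  -- do not involve it.
  obtain ⟨h₀, hh₀⟩ := hA.exists
  have hli : LinearIndependent ℂ A'.col := by
    have := (linearIndependent_col_of_isUnit_det_gram hh₀).comp
      (Subtype.val : {k // k ≠ j} → ν) Subtype.val_injective
    rw [← hsub h₀]
    exact this
  obtain ⟨B, hB⟩ := exists_isColumnComplement A' hli
  have hν : 0 < Fintype.card ν := Fintype.card_pos_iff.2 ⟨j⟩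
  -- The complement omits column j, so its dimension is one more than the excess d + 1 of rows over
  -- columns; the resulting d + 2 ≥ 2 makes the inverse moment finite.
  obtain ⟨d, hd⟩ : ∃ d, Fintype.card ι = Fintype.card ν + (d + 1) :=
    ⟨Fintype.card ι - Fintype.card ν - 1, by omega⟩
  have hcardB : Fintype.card (Fin (Fintype.card ι - Fintype.card {k // k ≠ j})) = d + 2 := by
    rw [Fintype.card_fin, Fintype.card_subtype_compl, Fintype.card_subtype_eq]
    omega
  have hval : (Fintype.card ι : ℝ) - Fintype.card ν = d + 1 := by
    rw [hd]; push_cast; ring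
  rw [hval, ← lintegral_inv_sum_normSq_mulVec B hB.mul_conjTranspose hcardB]
  refine lintegral_congr_ae ?_
  filter_upwards [hA] with h hh
  have h1 := inv_gram_apply_mul_sum_normSq hh j (by rw [hsub h]; exact hB)
  rw [hcol] at h1
  rw [eq_inv_of_mul_eq_one_left h1, ← Complex.ofReal_inv, Complex.ofReal_re,
    ENNReal.ofReal_inv_of_pos]
  refine lt_of_le_of_ne (by positivity) fun h0 => ?_
  rw [← h0] at h1
  simp at h1

/-- Column j is independent of the rest, so the law of H is a product and the conditional mean,
which is the same constant for almost all values of the rest, can be integrated. -/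
theorem lintegral_inv_gram_apply {ι ν Ω : Type*} [Fintype ι] [Fintype ν] [DecidableEq ν]
    [MeasurableSpace Ω] {P : Measure Ω} [IsProbabilityMeasure P]
    (hcard : Fintype.card ν < Fintype.card ι) (H : Ω → Matrix ι ν ℂ)
    (hH : IsIIDComplexGaussian P fun (p : ι × ν) ω => H ω p.1 p.2)
    (hdet : ∀ᵐ ω ∂P, IsUnit ((H ω)ᴴ * H ω).det) (j : ν) :
    ∫⁻ ω, ENNReal.ofReal (((H ω)ᴴ * H ω)⁻¹ j j).re ∂P =
      ENNReal.ofReal (1 / ((Fintype.card ι : ℝ) - Fintype.card ν)) := by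
  classical
  let u : Ω → ι → ℂ := fun ω i => H ω i j
  let v : Ω → ι × {k // k ≠ j} → ℂ := fun ω p => H ω p.1 p.2
  have hu : HasLaw u (Measure.pi fun _ => complexGaussian) P :=
    (hH.indep.precomp (g := fun i : ι => (i, j)) (Prod.mk_left_injective j)).hasLaw_pi
      fun i => hH.hasLaw (i, j)
  have hv : HasLaw v (Measure.pi fun _ => complexGaussian) P :=
    (hH.indep.precomp (g := fun p : ι × {k // k ≠ j} => (p.1, (p.2 : ν)))
      (Function.injective_id.prodMap Subtype.val_injective)).hasLaw_pi
      fun p => hH.hasLaw (p.1, p.2)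
  have huv : IndepFun v u P := by
    have h := hH.indep.indepFun_finset₀ (Finset.univ.filter fun p => p.2 ≠ j)
      (Finset.univ.filter fun p => p.2 = j) (Finset.disjoint_filter.2 fun p _ h1 h2 => h1 h2)
      fun p => (hH.hasLaw p).aemeasurable
    exact h.comp
      (φ := fun x (p : ι × {k // k ≠ j}) => x ⟨(p.1, (p.2 : ν)), by simpa using p.2.2⟩)
      (ψ := fun x (i : ι) => x ⟨(i, j), by simp⟩)
      (measurable_pi_lambda _ fun _ => measurable_pi_apply _)
      (measurable_pi_lambda _ fun _ => measurable_pi_apply _)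
  have hlaw := huv.hasLaw_prod hv hu
  have hHins : ∀ ω, H ω = Matrix.insertCol j (u ω) (v ω) := fun ω => by
    ext i k
    by_cases hk : k = j
    · simp [Matrix.insertCol, hk, u]
    · simp [Matrix.insertCol, hk, v]
  have hgram := Measurable.matrix_mul_apply
    (Measurable.matrix_conjTranspose_apply (measurable_insertCol_apply (ι := ι) j))
    (measurable_insertCol_apply (ι := ι) j)
  simp_rw [hHins] at hdet ⊢
  have hF : Measurable fun p : (ι × {k // k ≠ j} → ℂ) × (ι → ℂ) => ENNReal.ofReal
      (((Matrix.insertCol j p.2 p.1)ᴴ * Matrix.insertCol j p.2 p.1)⁻¹ j j).re :=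
    (Complex.measurable_re.comp (Measurable.matrix_inv_apply hgram j j)).ennreal_ofReal
  -- Almost sure invertibility is transported to the product law, where it can be sliced: for almost
  -- all A it holds for almost all columns h.
  have hdet' : ∀ᵐ p ∂((Measure.pi fun _ : ι × {k // k ≠ j} => complexGaussian).prod
      (Measure.pi fun _ : ι => complexGaussian)),
      IsUnit ((Matrix.insertCol j p.2 p.1)ᴴ * Matrix.insertCol j p.2 p.1).det := by
    rw [← hlaw.map_eq, ae_map_iff hlaw.aemeasurable]
    · exact hdet
    · simp only [isUnit_iff_ne_zero]
      exact (measurableSet_eq_fun (Measurable.matrix_det hgram) measurable_const).compl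
  calc _ = ∫⁻ p, ENNReal.ofReal
        (((Matrix.insertCol j p.2 p.1)ᴴ * Matrix.insertCol j p.2 p.1)⁻¹ j j).re
        ∂((Measure.pi fun _ : ι × {k // k ≠ j} => complexGaussian).prod
          (Measure.pi fun _ : ι => complexGaussian)) :=
        hlaw.lintegral_comp hF.aemeasurable
    _ = ∫⁻ A : ι × {k // k ≠ j} → ℂ,
          ENNReal.ofReal (1 / ((Fintype.card ι : ℝ) - Fintype.card ν))
          ∂Measure.pi fun _ => complexGaussian := by
        rw [lintegral_prod _ hF.aemeasurable]
        refine lintegral_congr_ae ?_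
        filter_upwards [Measure.ae_ae_of_ae_prod hdet'] with A hA
        exact lintegral_inv_gram_insertCol hcard j A hA
    _ = _ := by simp

open scoped ComplexOrder in
theorem inv_gram_apply_self_nonneg {ι ν : Type*} [Fintype ι] [Fintype ν] [DecidableEq ν]
    (H : Matrix ι ν ℂ) (j : ν) : 0 ≤ (Hᴴ * H)⁻¹ j j :=
  (Matrix.posSemidef_conjTranspose_mul_self H).inv.diag_nonneg

theorem trace_inv_gram_eq_sum_re {ι ν : Type*} [Fintype ι] [Fintype ν] [DecidableEq ν]
    (H : Matrix ι ν ℂ) : ((Hᴴ * H)⁻¹).trace = ((∑ j, ((Hᴴ * H)⁻¹ j j).re : ℝ) : ℂ) := by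
  rw [Matrix.trace, Complex.ofReal_sum]
  refine Finset.sum_congr rfl fun j _ => ?_
  apply Complex.ext
  · rw [Complex.ofReal_re, Matrix.diag_apply]
  · rw [Complex.ofReal_im, Matrix.diag_apply]
    exact (Complex.nonneg_iff.1 (inv_gram_apply_self_nonneg H j)).2.symm

theorem aemeasurable_inv_gram_apply {ι ν Ω : Type*} [Fintype ι] [Fintype ν] [DecidableEq ν]
    [MeasurableSpace Ω] {P : Measure Ω} {H : Ω → Matrix ι ν ℂ}
    (hH : ∀ i k, AEMeasurable (fun ω => H ω i k) P) (j k : ν) :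
    AEMeasurable (fun ω => ((H ω)ᴴ * H ω)⁻¹ j k) P := by
  let F : (ι × ν → ℂ) → Matrix ι ν ℂ := fun x => Matrix.of fun i k => x (i, k)
  have hF : ∀ i k, Measurable fun x => F x i k := fun i k => by
    simp only [F, Matrix.of_apply]
    fun_prop
  have h := Measurable.matrix_inv_apply (Measurable.matrix_mul_apply
    (Measurable.matrix_conjTranspose_apply hF) hF) j k
  have hX : AEMeasurable (fun ω (p : ι × ν) => H ω p.1 p.2) P :=
    aemeasurable_pi_lambda _ fun p => hH p.1 p.2
  have e : ∀ ω, F (fun p => H ω p.1 p.2) = H ω := fun _ => rfl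
  exact (h.comp_aemeasurable hX).congr (.of_forall fun ω => by simp only [Function.comp_apply, e])

/-- The mean of the trace of a complex inverse Wishart matrix. -/
theorem integrable_and_integral_trace_inv_gram {ι ν Ω : Type*} [Fintype ι] [Fintype ν]
    [DecidableEq ν] [MeasurableSpace Ω] {P : Measure Ω} [IsProbabilityMeasure P]
    (hcard : Fintype.card ν < Fintype.card ι) (H : Ω → Matrix ι ν ℂ)
    (hH : IsIIDComplexGaussian P fun (p : ι × ν) ω => H ω p.1 p.2)
    (hdet : ∀ᵐ ω ∂P, IsUnit ((H ω)ᴴ * H ω).det) :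
    Integrable (fun ω => (((H ω)ᴴ * H ω)⁻¹).trace) P ∧
      ∫ ω, (((H ω)ᴴ * H ω)⁻¹).trace ∂P =
        ((Fintype.card ν / ((Fintype.card ι : ℝ) - Fintype.card ν) : ℝ) : ℂ) := by
  have hpos : (0 : ℝ) < (Fintype.card ι : ℝ) - Fintype.card ν := by
    rw [sub_pos]; exact_mod_cast hcard
  have hmeas : ∀ j, AEMeasurable (fun ω => (((H ω)ᴴ * H ω)⁻¹ j j).re) P := fun j =>
    Complex.measurable_re.comp_aemeasurable
      (aemeasurable_inv_gram_apply (fun i k => (hH.hasLaw (i, k)).aemeasurable) j j)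
  have hre : ∀ ω j, 0 ≤ (((H ω)ᴴ * H ω)⁻¹ j j).re := fun ω j =>
    (Complex.nonneg_iff.1 (inv_gram_apply_self_nonneg (H ω) j)).1
  have hl := fun j => lintegral_inv_gram_apply hcard H hH hdet j
  have hint : ∀ j, Integrable (fun ω => (((H ω)ᴴ * H ω)⁻¹ j j).re) P := fun j =>
    ⟨(hmeas j).aestronglyMeasurable, by
      rw [hasFiniteIntegral_iff_ofReal (.of_forall fun ω => hre ω j), hl j]
      exact ENNReal.ofReal_lt_top⟩
  have hval : ∀ j, ∫ ω, (((H ω)ᴴ * H ω)⁻¹ j j).re ∂P =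
      1 / ((Fintype.card ι : ℝ) - Fintype.card ν) := fun j => by
    rw [integral_eq_lintegral_of_nonneg_ae (.of_forall fun ω => hre ω j)
      (hmeas j).aestronglyMeasurable, hl j, ENNReal.toReal_ofReal (by positivity)]
  simp_rw [trace_inv_gram_eq_sum_re]
  refine ⟨(integrable_finsetSum _ fun j _ => hint j).ofReal, ?_⟩
  rw [integral_complex_ofReal, integral_finsetSum _ fun j _ => hint j]
  simp_rw [hval]
  rw [Finset.sum_const, Finset.card_univ, nsmul_eq_mul, mul_one_div]

/-! ### Algebra of the decomposition. -/

/-- Each row and each column has at most one nonzero entry; columns with j ≥ m vanish. -/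
theorem gsvdSigma₁_gram (m n : ℕ) (α : Fin (gsvdCount m n) → ℝ) :
    (gsvdSigma₁ m n α)ᴴ * gsvdSigma₁ m n α = Matrix.diagonal fun j : Fin n =>
      if (j : ℕ) < m then
        (if h : gsvdShift m n ≤ j ∧ (j : ℕ) - gsvdShift m n < gsvdCount m n then
          (((α ⟨(j : ℕ) - gsvdShift m n, h.2⟩) ^ 2 : ℝ) : ℂ) else 1)
      else 0 := by
  ext j j'
  rw [Matrix.mul_apply]
  by_cases hj : j = j'
  · subst hj
    rw [Matrix.diagonal_apply_eq]
    split_ifs with hm h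
    · rw [Finset.sum_eq_single ⟨j, hm⟩]
      · simp only [Matrix.conjTranspose_apply, gsvdSigma₁, Matrix.of_apply, if_true, dif_pos h]
        simp [sq]
      · intro i _ hi
        have : (i : ℕ) ≠ j := fun e => hi (Fin.ext e)
        simp [gsvdSigma₁, this]
      · simp
    · rw [Finset.sum_eq_single ⟨j, hm⟩]
      · simp only [Matrix.conjTranspose_apply, gsvdSigma₁, Matrix.of_apply, if_true, dif_neg h]
        simp
      · intro i _ hi
        have : (i : ℕ) ≠ j := fun e => hi (Fin.ext e)
        simp [gsvdSigma₁, this]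
      · simp
    · refine Finset.sum_eq_zero fun i _ => ?_
      have : (i : ℕ) ≠ j := by have := i.2; omega
      simp [gsvdSigma₁, this]
  · rw [Matrix.diagonal_apply_ne _ hj]
    refine Finset.sum_eq_zero fun i _ => ?_
    by_cases hi : (i : ℕ) = j
    · have : (i : ℕ) ≠ j' := fun e => hj (Fin.ext (hi.symm.trans e))
      simp [gsvdSigma₁, this]
    · simp [gsvdSigma₁, hi]

theorem gsvdSigma₂_gram (m n : ℕ) (β : Fin (gsvdCount m n) → ℝ) :
    (gsvdSigma₂ m n β)ᴴ * gsvdSigma₂ m n β = Matrix.diagonal fun j : Fin n =>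
      if n ≤ (j : ℕ) + m then
        (if h : gsvdShift m n ≤ j ∧ (j : ℕ) - gsvdShift m n < gsvdCount m n then
          (((β ⟨(j : ℕ) - gsvdShift m n, h.2⟩) ^ 2 : ℝ) : ℂ) else 1)
      else 0 := by
  ext j j'
  rw [Matrix.mul_apply]
  by_cases hj : j = j'
  · subst hj
    rw [Matrix.diagonal_apply_eq]
    split_ifs with hm h
    · rw [Finset.sum_eq_single ⟨j + m - n, by omega⟩]
      · have : (j : ℕ) + m - n + n = j + m := by omega
        simp only [Matrix.conjTranspose_apply, gsvdSigma₂, Matrix.of_apply, dif_pos h, this,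
          if_true]
        simp [sq]
      · intro i _ hi
        have : (i : ℕ) + n ≠ j + m := fun e => hi (Fin.ext (by simp only; omega))
        simp [gsvdSigma₂, this]
      · simp
    · rw [Finset.sum_eq_single ⟨j + m - n, by omega⟩]
      · have : (j : ℕ) + m - n + n = j + m := by omega
        simp only [Matrix.conjTranspose_apply, gsvdSigma₂, Matrix.of_apply, dif_neg h, this,
          if_true]
        simp
      · intro i _ hi
        have : (i : ℕ) + n ≠ j + m := fun e => hi (Fin.ext (by simp only; omega))
        simp [gsvdSigma₂, this]
      · simp
    · refine Finset.sum_eq_zero fun i _ => ?_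
      have : (i : ℕ) + n ≠ j + m := by omega
      simp [gsvdSigma₂, this]
  · rw [Matrix.diagonal_apply_ne _ hj]
    refine Finset.sum_eq_zero fun i _ => ?_
    by_cases hi : (i : ℕ) + n = j + m
    · have : (i : ℕ) + n ≠ j' + m := fun e => hj (Fin.ext (by omega))
      simp [gsvdSigma₂, this]
    · simp [gsvdSigma₂, hi]

/-- Columns in the middle block contribute α² + β². Since `n < 2 * m`, every other column is nonzero
in exactly one of Σ₁, Σ₂, where its entry is 1. -/
theorem gsvdSigma_gram_add_gram {m n : ℕ} (hmn : n < 2 * m) (α β : Fin (gsvdCount m n) → ℝ)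
    (h : ∀ i, α i ^ 2 + β i ^ 2 = 1) :
    (gsvdSigma₁ m n α)ᴴ * gsvdSigma₁ m n α + (gsvdSigma₂ m n β)ᴴ * gsvdSigma₂ m n β = 1 := by
  rw [gsvdSigma₁_gram, gsvdSigma₂_gram, Matrix.diagonal_add, ← Matrix.diagonal_one]
  congr 1
  ext j
  have hj := j.2
  by_cases hmid : gsvdShift m n ≤ j ∧ (j : ℕ) - gsvdShift m n < gsvdCount m n
  · have h1 : (j : ℕ) < m := by simp only [gsvdShift, gsvdCount] at hmid; omega
    have h2 : n ≤ (j : ℕ) + m := by simp only [gsvdShift, gsvdCount] at hmid; omega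
    rw [if_pos h1, if_pos h2, dif_pos hmid, dif_pos hmid, ← Complex.ofReal_add, h,
      Complex.ofReal_one]
  · rw [dif_neg hmid, dif_neg hmid]
    by_cases h1 : (j : ℕ) < m
    · have h2 : ¬ n ≤ (j : ℕ) + m := by simp only [gsvdShift, gsvdCount] at hmid; omega
      rw [if_pos h1, if_neg h2, add_zero]
    · have h2 : n ≤ (j : ℕ) + m := by omega
      rw [if_neg h1, if_pos h2, zero_add]

theorem Matrix.gram_unitary_mul {ι ν : Type*} [Fintype ι] [DecidableEq ι] [Fintype ν]
    {U : Matrix ι ι ℂ} (hU : U ∈ Matrix.unitaryGroup ι ℂ) (M : Matrix ι ν ℂ) :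
    (U * M)ᴴ * (U * M) = Mᴴ * M := by
  have h : Uᴴ * U = 1 := Matrix.mem_unitaryGroup_iff'.1 hU
  rw [Matrix.conjTranspose_mul, Matrix.mul_assoc, ← Matrix.mul_assoc Uᴴ, h, Matrix.one_mul]

namespace IsGSVD

variable {m n : ℕ} {A₁ A₂ : Matrix (Fin m) (Fin n) ℂ} {U V : Matrix (Fin m) (Fin m) ℂ}
  {Q : Matrix (Fin n) (Fin n) ℂ} {α β : Fin (gsvdCount m n) → ℝ}

theorem gram_left (h : IsGSVD A₁ A₂ U V Q α β) :
    (A₁ * Q)ᴴ * (A₁ * Q) = (gsvdSigma₁ m n α)ᴴ * gsvdSigma₁ m n α := by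
  rw [← h.eq_sigma₁, Matrix.mul_assoc, Matrix.gram_unitary_mul h.unitary_left]

theorem gram_right (h : IsGSVD A₁ A₂ U V Q α β) :
    (A₂ * Q)ᴴ * (A₂ * Q) = (gsvdSigma₂ m n β)ᴴ * gsvdSigma₂ m n β := by
  rw [← h.eq_sigma₂, Matrix.mul_assoc, Matrix.gram_unitary_mul h.unitary_right]

theorem gram_mul_mul_conjTranspose (h : IsGSVD A₁ A₂ U V Q α β) (hmn : n < 2 * m) :
    ((Matrix.fromRows A₁ A₂)ᴴ * Matrix.fromRows A₁ A₂) * (Q * Qᴴ) = 1 := by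
  have h1 := gsvdSigma_gram_add_gram hmn α β h.sq_add_sq
  rw [← h.gram_left, ← h.gram_right] at h1
  -- One-sided inverses of square matrices are two-sided, so it suffices to show Qᴴ(HᴴH)Q = 1, which
  -- is the sum of the two Gram identities.
  rw [← Matrix.mul_assoc, mul_eq_one_comm, ← h1,
    Matrix.conjTranspose_fromRows_eq_fromCols_conjTranspose, Matrix.fromCols_mul_fromRows]
  simp only [Matrix.conjTranspose_mul, Matrix.add_mul, Matrix.mul_add, Matrix.mul_assoc]

theorem isUnit_det_gram (h : IsGSVD A₁ A₂ U V Q α β) (hmn : n < 2 * m) :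
    IsUnit ((Matrix.fromRows A₁ A₂)ᴴ * Matrix.fromRows A₁ A₂).det :=
  Matrix.isUnit_det_of_right_inverse (h.gram_mul_mul_conjTranspose hmn)

theorem mul_conjTranspose_eq_inv_gram (h : IsGSVD A₁ A₂ U V Q α β) (hmn : n < 2 * m) :
    Q * Qᴴ = ((Matrix.fromRows A₁ A₂)ᴴ * Matrix.fromRows A₁ A₂)⁻¹ :=
  (Matrix.inv_eq_right_inv (h.gram_mul_mul_conjTranspose hmn)).symm

end IsGSVD

/-! ### Recovering α and β from the channel and Q. -/

/-- The column of `Σ₁` and `Σ₂` that holds the `i`-th generalized singular value. -/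
def gsvdIndex {m n : ℕ} (i : Fin (gsvdCount m n)) : Fin n :=
  ⟨i + gsvdShift m n, by have := i.2; simp only [gsvdShift, gsvdCount] at this ⊢; omega⟩

/-- The generalized singular values as a function of the matrix `H₁ Q` or `H₂ Q`. -/
noncomputable def gsvdValues {m n : ℕ} (M : Matrix (Fin m) (Fin n) ℂ)
    (i : Fin (gsvdCount m n)) : ℝ :=
  √((Mᴴ * M) (gsvdIndex i) (gsvdIndex i)).re

namespace IsGSVD

variable {m n : ℕ} {A₁ A₂ : Matrix (Fin m) (Fin n) ℂ} {U V : Matrix (Fin m) (Fin m) ℂ}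
  {Q : Matrix (Fin n) (Fin n) ℂ} {α β : Fin (gsvdCount m n) → ℝ}

/-- Neither measurability of α, β nor their independence of the messages is assumed; both are
inherited from (H₁, H₂, Q), up to null sets, through this formula. Nonnegativity selects the square
root. -/
theorem gsvdValues_left (h : IsGSVD A₁ A₂ U V Q α β) : gsvdValues (A₁ * Q) = α := by
  ext i
  have hi := i.2
  have h1 : ((gsvdIndex i : Fin n) : ℕ) < m := by
    simp only [gsvdIndex, gsvdShift, gsvdCount] at hi ⊢; omega
  have h2 : gsvdShift m n ≤ ((gsvdIndex i : Fin n) : ℕ) ∧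
      ((gsvdIndex i : Fin n) : ℕ) - gsvdShift m n < gsvdCount m n := by
    simp only [gsvdIndex, gsvdShift, gsvdCount] at hi ⊢; omega
  have h3 : (⟨((gsvdIndex i : Fin n) : ℕ) - gsvdShift m n, h2.2⟩ : Fin (gsvdCount m n)) = i :=
    Fin.ext (by simp [gsvdIndex])
  rw [gsvdValues, h.gram_left, gsvdSigma₁_gram, Matrix.diagonal_apply_eq, if_pos h1,
    dif_pos h2, h3, Complex.ofReal_re, Real.sqrt_sq (h.alpha_nonneg i)]

theorem gsvdValues_right (h : IsGSVD A₁ A₂ U V Q α β) : gsvdValues (A₂ * Q) = β := by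
  ext i
  have hi := i.2
  have h1 : n ≤ ((gsvdIndex i : Fin n) : ℕ) + m := by
    simp only [gsvdIndex, gsvdShift, gsvdCount] at hi ⊢; omega
  have h2 : gsvdShift m n ≤ ((gsvdIndex i : Fin n) : ℕ) ∧
      ((gsvdIndex i : Fin n) : ℕ) - gsvdShift m n < gsvdCount m n := by
    simp only [gsvdIndex, gsvdShift, gsvdCount] at hi ⊢; omega
  have h3 : (⟨((gsvdIndex i : Fin n) : ℕ) - gsvdShift m n, h2.2⟩ : Fin (gsvdCount m n)) = i :=
    Fin.ext (by simp [gsvdIndex])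
  rw [gsvdValues, h.gram_right, gsvdSigma₂_gram, Matrix.diagonal_apply_eq, if_pos h1,
    dif_pos h2, h3, Complex.ofReal_re, Real.sqrt_sq (h.beta_nonneg i)]

end IsGSVD

theorem Measurable.gsvdValues {m n : ℕ} {Ω : Type*} [MeasurableSpace Ω]
    {M : Ω → Matrix (Fin m) (Fin n) ℂ} (hM : ∀ i j, Measurable fun ω => M ω i j)
    (i : Fin (gsvdCount m n)) : Measurable fun ω => gsvdValues (M ω) i :=
  (Complex.measurable_re.comp (Measurable.matrix_mul_apply
    (Measurable.matrix_conjTranspose_apply hM) hM _ _)).sqrt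

/-! ### The superposition matrix. -/

/-- The amplitudes with which the `j`-th messages of the two users enter `nomaSymbol`. -/
noncomputable def nomaWeight {m n : ℕ} (d₁ d₂ τ l₁ l₂ : ℝ)
    (α β : Fin (gsvdCount m n) → ℝ) (j : Fin n) : ℝ × ℝ :=
  if (j : ℕ) < gsvdShift m n then (1, 0)
  else if h : (j : ℕ) - gsvdShift m n < gsvdCount m n then
    (if β ⟨(j : ℕ) - gsvdShift m n, h⟩ / √(d₂ ^ τ) < α ⟨(j : ℕ) - gsvdShift m n, h⟩ / √(d₁ ^ τ)
      then (l₂, l₁) else (l₁, l₂))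
  else (0, 1)

section nomaWeight

variable {m n : ℕ} (d₁ d₂ τ l₁ l₂ : ℝ) (α β : Fin (gsvdCount m n) → ℝ)

/-- The matrix that maps the messages of both users to the transmitted vector. -/
noncomputable def nomaMatrix : Matrix (Fin n) (Fin n ⊕ Fin n) ℂ :=
  Matrix.fromCols
    (Matrix.diagonal fun j => ((nomaWeight d₁ d₂ τ l₁ l₂ α β j).1 : ℂ))
    (Matrix.diagonal fun j => ((nomaWeight d₁ d₂ τ l₁ l₂ α β j).2 : ℂ))

theorem nomaSymbol_eq_nomaMatrix_mulVec (s₁ s₂ : Fin n → ℂ) :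
    nomaSymbol d₁ d₂ τ l₁ l₂ α β s₁ s₂ =
      nomaMatrix d₁ d₂ τ l₁ l₂ α β *ᵥ Sum.elim s₁ s₂ := by
  ext j
  rw [nomaMatrix, Matrix.fromCols_mulVec_sumElim, Pi.add_apply, Matrix.mulVec_diagonal,
    Matrix.mulVec_diagonal, nomaSymbol, nomaWeight]
  split_ifs <;> simp

variable {l₁ l₂}

/-- Swapping l₁ and l₂ preserves the sum of squares, so the comparison of subchannels does not
affect the mean power. -/
theorem nomaMatrix_mul_conjTranspose (hl : l₁ ^ 2 + l₂ ^ 2 = 1) :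
    nomaMatrix d₁ d₂ τ l₁ l₂ α β * (nomaMatrix d₁ d₂ τ l₁ l₂ α β)ᴴ = 1 := by
  rw [nomaMatrix, Matrix.conjTranspose_fromCols_eq_fromRows_conjTranspose,
    Matrix.fromCols_mul_fromRows, Matrix.diagonal_conjTranspose, Matrix.diagonal_conjTranspose,
    Matrix.diagonal_mul_diagonal, Matrix.diagonal_mul_diagonal, Matrix.diagonal_add,
    ← Matrix.diagonal_one]
  congr 1
  ext j
  have h : (nomaWeight d₁ d₂ τ l₁ l₂ α β j).1 ^ 2 + (nomaWeight d₁ d₂ τ l₁ l₂ α β j).2 ^ 2 = 1 := by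
    rw [nomaWeight]
    split_ifs <;> simp <;> linarith
  simp only [Pi.star_apply, Complex.star_def, Complex.conj_ofReal]
  exact_mod_cast (by rw [← sq, ← sq]; exact h)

end nomaWeight

theorem measurable_nomaMatrix_apply {m n : ℕ} (d₁ d₂ τ l₁ l₂ : ℝ) {Ω : Type*} [MeasurableSpace Ω]
    {α β : Ω → Fin (gsvdCount m n) → ℝ} (hα : ∀ i, Measurable fun ω => α ω i)
    (hβ : ∀ i, Measurable fun ω => β ω i) (j : Fin n) (k : Fin n ⊕ Fin n) :
    Measurable fun ω => nomaMatrix d₁ d₂ τ l₁ l₂ (α ω) (β ω) j k := by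
  have h : ∀ j, Measurable fun ω => nomaWeight d₁ d₂ τ l₁ l₂ (α ω) (β ω) j := fun j => by
    unfold nomaWeight
    split_ifs
    · exact measurable_const
    · exact Measurable.ite (measurableSet_lt ((hβ _).div_const _) ((hα _).div_const _))
        measurable_const measurable_const
    · exact measurable_const
  rcases k with k | k
  · simp only [nomaMatrix, Matrix.fromCols_apply_inl, Matrix.diagonal_apply]
    split_ifs
    · exact Complex.measurable_ofReal.comp (h j).fst
    · exact measurable_const
  · simp only [nomaMatrix, Matrix.fromCols_apply_inr, Matrix.diagonal_apply]
    split_ifs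
    · exact Complex.measurable_ofReal.comp (h j).snd
    · exact measurable_const

/-! ### Averaging over the messages. -/

namespace IsIIDComplexGaussian

variable {ι Ω : Type*} [MeasurableSpace Ω] {P : Measure Ω} {X : ι → Ω → ℂ}

theorem memLp_two (hX : IsIIDComplexGaussian P X) (i : ι) : MemLp (X i) 2 P := by
  have h := memLp_two_id_complexGaussian
  rw [← (hX.hasLaw i).map_eq] at h
  exact h.comp_of_map (hX.hasLaw i).aemeasurable

theorem integral_eq_zero (hX : IsIIDComplexGaussian P X) (i : ι) : ∫ ω, X i ω ∂P = 0 := by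
  rw [(hX.hasLaw i).integral_eq, integral_id_complexGaussian]

theorem integral_mul_star [DecidableEq ι] (hX : IsIIDComplexGaussian P X) (i j : ι) :
    ∫ ω, X i ω * star (X j ω) ∂P = if i = j then 1 else 0 := by
  split_ifs with hij
  · subst hij
    have h := (hX.hasLaw i).integral_comp (f := fun z : ℂ => z * star z) (by fun_prop)
    rw [integral_normSq_complexGaussian] at h
    exact h
  · have h := ((hX.indep.indepFun hij).comp measurable_id
      (continuous_star (R := ℂ)).measurable).integral_fun_mul_eq_mul_integral
      (hX.memLp_two i).aestronglyMeasurable (hX.memLp_two j).star.aestronglyMeasurable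
    simp only [Function.comp_apply, id_eq] at h
    rw [h, hX.integral_eq_zero, zero_mul]

theorem integrable_mul_star (hX : IsIIDComplexGaussian P X) (i j : ι) :
    Integrable (fun ω => X i ω * star (X j ω)) P :=
  (hX.memLp_two i).integrable_mul (hX.memLp_two j).star

end IsIIDComplexGaussian

theorem Matrix.trace_mul_conjTranspose_eq_sum {ι κ : Type*} [Fintype ι] [Fintype κ]
    (M : Matrix ι κ ℂ) : (M * Mᴴ).trace = ∑ a, ∑ u, M a u * star (M a u) := rfl

theorem Matrix.trace_mul_vecMulVec_mul_conjTranspose {ι κ : Type*} [Fintype ι] [Fintype κ]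
    (M : Matrix ι κ ℂ) (s : κ → ℂ) :
    (M * Matrix.vecMulVec s (star s) * Mᴴ).trace =
      ∑ a, ∑ u, ∑ v, (M a u * star (M a v)) * (s u * star (s v)) := by
  rw [Matrix.mul_vecMulVec, Matrix.vecMulVec_mul, Matrix.trace]
  refine Finset.sum_congr rfl fun a _ => ?_
  simp only [Matrix.diag_apply, Matrix.vecMulVec_apply, Matrix.mulVec, Matrix.vecMul, dotProduct,
    Finset.sum_mul_sum, Matrix.conjTranspose_apply, Pi.star_apply]
  refine Finset.sum_congr rfl fun u _ => Finset.sum_congr rfl fun v _ => ?_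
  ring

/-- The mean power of a random linear combination of i.i.d. complex Gaussians, with coefficients
independent of them. -/
theorem integrable_and_integral_trace_mul_vecMulVec {ι κ Ω : Type*} [Fintype ι] [Fintype κ]
    [MeasurableSpace Ω] {P : Measure Ω} [IsProbabilityMeasure P]
    {M : Ω → Matrix ι κ ℂ} {s : Ω → κ → ℂ}
    (hM : ∀ a u, AEMeasurable (fun ω => M ω a u) P)
    (hs : IsIIDComplexGaussian P fun u ω => s ω u)
    (hind : IndepFun (fun ω (p : ι × κ) => M ω p.1 p.2) s P)
    (hint : Integrable (fun ω => (M ω * (M ω)ᴴ).trace) P) :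
    Integrable (fun ω => (M ω * Matrix.vecMulVec (s ω) (star (s ω)) * (M ω)ᴴ).trace) P ∧
      ∫ ω, (M ω * Matrix.vecMulVec (s ω) (star (s ω)) * (M ω)ᴴ).trace ∂P =
        ∫ ω, (M ω * (M ω)ᴴ).trace ∂P := by
  classical
  -- The trace of MMᴴ is the sum of all squared entry norms and so dominates each of them.
  have hM2 : ∀ a u, MemLp (fun ω => M ω a u) 2 P := fun a u => by
    rw [memLp_two_iff_integrable_sq_norm (hM a u).aestronglyMeasurable]
    refine hint.norm.mono' ((hM a u).norm.pow_const 2).aestronglyMeasurable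
      (.of_forall fun ω => ?_)
    have : (M ω * (M ω)ᴴ).trace = ((∑ b, ∑ v, ‖M ω b v‖ ^ 2 : ℝ) : ℂ) := by
      rw [Matrix.trace_mul_conjTranspose_eq_sum]
      simp [Complex.mul_conj']
    rw [this, Complex.norm_real, Real.norm_of_nonneg (by positivity),
      Real.norm_of_nonneg (by positivity)]
    calc _ ≤ ∑ v, ‖M ω a v‖ ^ 2 := Finset.single_le_sum (f := fun v => ‖M ω a v‖ ^ 2)
          (fun v _ => by positivity) (Finset.mem_univ u)
      _ ≤ _ := Finset.single_le_sum (f := fun b => ∑ v, ‖M ω b v‖ ^ 2)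
          (fun b _ => by positivity) (Finset.mem_univ a)
  have hMM : ∀ a u v, Integrable (fun ω => M ω a u * star (M ω a v)) P := fun a u v =>
    (hM2 a u).integrable_mul (hM2 a v).star
  have hcomp : ∀ a u v, IndepFun (fun ω => M ω a u * star (M ω a v))
      (fun ω => s ω u * star (s ω v)) P := fun a u v =>
    hind.comp (φ := fun x : ι × κ → ℂ => x (a, u) * star (x (a, v)))
      (ψ := fun x : κ → ℂ => x u * star (x v)) (by fun_prop) (by fun_prop)
  -- Independence makes a product of two integrable factors integrable, so no fourth moments are
  -- needed.
  have hterm : ∀ a u v, Integrable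
      (fun ω => (M ω a u * star (M ω a v)) * (s ω u * star (s ω v))) P := fun a u v =>
    (hcomp a u v).integrable_mul (hMM a u v) (hs.integrable_mul_star u v)
  simp_rw [Matrix.trace_mul_vecMulVec_mul_conjTranspose, Matrix.trace_mul_conjTranspose_eq_sum]
  refine ⟨integrable_finsetSum _ fun a _ => integrable_finsetSum _ fun u _ =>
    integrable_finsetSum _ fun v _ => hterm a u v, ?_⟩
  rw [integral_finsetSum _ fun a _ => integrable_finsetSum _ fun u _ =>
    integrable_finsetSum _ fun v _ => hterm a u v,
    integral_finsetSum _ fun a _ => integrable_finsetSum _ fun u _ => hMM a u u]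
  refine Finset.sum_congr rfl fun a _ => ?_
  rw [integral_finsetSum _ fun u _ => integrable_finsetSum _ fun v _ => hterm a u v,
    integral_finsetSum _ fun u _ => hMM a u u]
  refine Finset.sum_congr rfl fun u _ => ?_
  -- Only v = u survives, because distinct messages are uncorrelated.
  rw [integral_finsetSum _ fun v _ => hterm a u v, Finset.sum_eq_single u]
  · rw [(hcomp a u u).integral_fun_mul_eq_mul_integral (hMM a u u).aestronglyMeasurable
      (hs.integrable_mul_star u u).aestronglyMeasurable, hs.integral_mul_star, if_pos rfl, mul_one]
  · intro v _ hv
    rw [(hcomp a u v).integral_fun_mul_eq_mul_integral (hMM a u v).aestronglyMeasurable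
      (hs.integrable_mul_star u v).aestronglyMeasurable, hs.integral_mul_star, if_neg hv.symm,
      mul_zero]
  · simp

theorem theorem2 (m n : ℕ) (hn : 0 < n) (hmn : n < 2 * m)
    {Ω : Type*} [MeasurableSpace Ω] (P : Measure Ω) [IsProbabilityMeasure P]
    -- the channel matrices: all entries of `H₁` and `H₂` are i.i.d. `CN(0,1)`
    (H₁ H₂ : Ω → Matrix (Fin m) (Fin n) ℂ)
    (hH : IsIIDComplexGaussian P (fun (p : (Fin m ⊕ Fin m) × Fin n) (ω : Ω) =>
      Matrix.fromRows (H₁ ω) (H₂ ω) p.1 p.2))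
    -- a generalized singular value decomposition of the channel matrices
    (U V : Ω → Matrix (Fin m) (Fin m) ℂ) (Q : Ω → Matrix (Fin n) (Fin n) ℂ)
    (α β : Ω → Fin (gsvdCount m n) → ℝ)
    (hGSVD : ∀ᵐ ω ∂P, IsGSVD (H₁ ω) (H₂ ω) (U ω) (V ω) (Q ω) (α ω) (β ω))
    (hQ : ∀ i j, AEMeasurable (fun ω => Q ω i j) P)
    -- the messages for the two users: i.i.d. `CN(0,1)`, independent of the channel and of `Q`
    (s₁ s₂ : Ω → Fin n → ℂ)
    (hs : IsIIDComplexGaussian P (fun (i : Fin n ⊕ Fin n) (ω : Ω) =>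
      Sum.elim (s₁ ω) (s₂ ω) i))
    (hindep : IndepFun
      (fun ω => ((fun p : (Fin m ⊕ Fin m) × Fin n =>
          Matrix.fromRows (H₁ ω) (H₂ ω) p.1 p.2),
        (fun p : Fin n × Fin n => Q ω p.1 p.2)))
      (fun ω => Sum.elim (s₁ ω) (s₂ ω)) P)
    -- distances, path loss exponent and power allocation coefficients
    (d₁ d₂ τ l₁ l₂ : ℝ) (hd₁ : 0 < d₁) (hd₂ : 0 < d₂) (hl : l₂ < l₁)
    (hl_sq : l₁ ^ 2 + l₂ ^ 2 = 1) :
    -- `Q Qᴴ = (Hᴴ H)⁻¹` for every decomposition of any two matrices of this size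
    (∀ (A₁ A₂ : Matrix (Fin m) (Fin n) ℂ) (U' V' : Matrix (Fin m) (Fin m) ℂ)
      (Q' : Matrix (Fin n) (Fin n) ℂ) (α' β' : Fin (gsvdCount m n) → ℝ),
      IsGSVD A₁ A₂ U' V' Q' α' β' →
        IsUnit ((Matrix.fromRows A₁ A₂)ᴴ * Matrix.fromRows A₁ A₂).det ∧
        Q' * Q'ᴴ = ((Matrix.fromRows A₁ A₂)ᴴ * Matrix.fromRows A₁ A₂)⁻¹) ∧
    -- all expectations are finite
    Integrable (fun ω => (Q ω * Matrix.vecMulVec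
      (nomaSymbol d₁ d₂ τ l₁ l₂ (α ω) (β ω) (s₁ ω) (s₂ ω))
      (star (nomaSymbol d₁ d₂ τ l₁ l₂ (α ω) (β ω) (s₁ ω) (s₂ ω))) * (Q ω)ᴴ).trace) P ∧
    Integrable (fun ω => (Q ω * (Q ω)ᴴ).trace) P ∧
    Integrable (fun ω =>
      (((Matrix.fromRows (H₁ ω) (H₂ ω))ᴴ * Matrix.fromRows (H₁ ω) (H₂ ω))⁻¹).trace) P ∧
    -- `t² = E[trace (Q Qᴴ)] = E[trace ((Hᴴ H)⁻¹)] = 1 / (2η - 1)`, `η = m / n`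
    powerNormSq P Q (fun ω => nomaSymbol d₁ d₂ τ l₁ l₂ (α ω) (β ω) (s₁ ω) (s₂ ω)) =
      ∫ ω, (Q ω * (Q ω)ᴴ).trace ∂P ∧
    ∫ ω, (Q ω * (Q ω)ᴴ).trace ∂P =
      ∫ ω, (((Matrix.fromRows (H₁ ω) (H₂ ω))ᴴ *
        Matrix.fromRows (H₁ ω) (H₂ ω))⁻¹).trace ∂P ∧
    ∫ ω, (((Matrix.fromRows (H₁ ω) (H₂ ω))ᴴ *
        Matrix.fromRows (H₁ ω) (H₂ ω))⁻¹).trace ∂P =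
      ((1 / (2 * ((m : ℝ) / (n : ℝ)) - 1) : ℝ) : ℂ) := by
  -- Full column rank comes from the existence of the decomposition rather than from the Gaussian
  -- law.
  have hdet : ∀ᵐ ω ∂P, IsUnit
      ((Matrix.fromRows (H₁ ω) (H₂ ω))ᴴ * Matrix.fromRows (H₁ ω) (H₂ ω)).det := by
    filter_upwards [hGSVD] with ω h using h.isUnit_det_gram hmn
  have hcard : Fintype.card (Fin n) < Fintype.card (Fin m ⊕ Fin m) := by
    simp only [Fintype.card_sum, Fintype.card_fin]; omega
  obtain ⟨hWint, hW⟩ := integrable_and_integral_trace_inv_gram hcard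
    (fun ω => Matrix.fromRows (H₁ ω) (H₂ ω)) hH hdet
  have hQW : (fun ω => (((Matrix.fromRows (H₁ ω) (H₂ ω))ᴴ *
      Matrix.fromRows (H₁ ω) (H₂ ω))⁻¹).trace) =ᵐ[P] fun ω => (Q ω * (Q ω)ᴴ).trace := by
    filter_upwards [hGSVD] with ω h
    rw [h.mul_conjTranspose_eq_inv_gram hmn]
  have hQint := hWint.congr hQW
  let C : Ω → Matrix (Fin n) (Fin n ⊕ Fin n) ℂ := fun ω =>
    nomaMatrix d₁ d₂ τ l₁ l₂ (α ω) (β ω)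
  have hCC : ∀ ω, Q ω * C ω * (Q ω * C ω)ᴴ = Q ω * (Q ω)ᴴ := fun ω => by
    rw [Matrix.conjTranspose_mul, Matrix.mul_assoc, ← Matrix.mul_assoc (C ω),
      nomaMatrix_mul_conjTranspose _ _ _ _ _ hl_sq, Matrix.one_mul]
  have hsymb : ∀ ω, Q ω * Matrix.vecMulVec
      (nomaSymbol d₁ d₂ τ l₁ l₂ (α ω) (β ω) (s₁ ω) (s₂ ω))
      (star (nomaSymbol d₁ d₂ τ l₁ l₂ (α ω) (β ω) (s₁ ω) (s₂ ω))) * (Q ω)ᴴ =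
      Q ω * C ω * Matrix.vecMulVec (Sum.elim (s₁ ω) (s₂ ω)) (star (Sum.elim (s₁ ω) (s₂ ω))) *
        (Q ω * C ω)ᴴ := fun ω => by
    rw [nomaSymbol_eq_nomaMatrix_mulVec, Matrix.star_mulVec, ← Matrix.vecMulVec_mul,
      ← Matrix.mul_vecMulVec, Matrix.conjTranspose_mul]
    simp only [Matrix.mul_assoc, C]
  -- the precoder applied to the superposition matrix is a.s. a function of `H₁`, `H₂` and `Q`
  let F : ((Fin m ⊕ Fin m) × Fin n → ℂ) × (Fin n × Fin n → ℂ) →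
      Matrix (Fin n) (Fin n ⊕ Fin n) ℂ := fun x =>
    let q : Matrix (Fin n) (Fin n) ℂ := Matrix.of fun i j => x.2 (i, j)
    q * nomaMatrix d₁ d₂ τ l₁ l₂
      (gsvdValues ((Matrix.of fun i j => x.1 (Sum.inl i, j) : Matrix (Fin m) (Fin n) ℂ) * q))
      (gsvdValues ((Matrix.of fun i j => x.1 (Sum.inr i, j) : Matrix (Fin m) (Fin n) ℂ) * q))
  have hF : ∀ i k, Measurable fun x => F x i k := by
    have hq : ∀ i j, Measurable fun x : ((Fin m ⊕ Fin m) × Fin n → ℂ) × (Fin n × Fin n → ℂ) =>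
        (Matrix.of fun i j => x.2 (i, j) : Matrix (Fin n) (Fin n) ℂ) i j := fun i j => by
      simp only [Matrix.of_apply]; fun_prop
    refine Measurable.matrix_mul_apply hq (measurable_nomaMatrix_apply _ _ _ _ _
      (Measurable.gsvdValues (Measurable.matrix_mul_apply (fun i j => ?_) hq))
      (Measurable.gsvdValues (Measurable.matrix_mul_apply (fun i j => ?_) hq)))
    all_goals simp only [Matrix.of_apply]; fun_prop
  let X : Ω → ((Fin m ⊕ Fin m) × Fin n → ℂ) × (Fin n × Fin n → ℂ) := fun ω =>
    (fun p => Matrix.fromRows (H₁ ω) (H₂ ω) p.1 p.2, fun p => Q ω p.1 p.2)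
  have hX : AEMeasurable X P :=
    (aemeasurable_pi_lambda _ fun p => (hH.hasLaw p).aemeasurable).prodMk
      (aemeasurable_pi_lambda _ fun p => hQ p.1 p.2)
  have hFX : ∀ᵐ ω ∂P, F (X ω) = Q ω * C ω := by
    filter_upwards [hGSVD] with ω h
    change Q ω * nomaMatrix d₁ d₂ τ l₁ l₂ (gsvdValues (H₁ ω * Q ω)) (gsvdValues (H₂ ω * Q ω)) = _
    rw [h.gsvdValues_left, h.gsvdValues_right]
  have hmeas : ∀ i k, AEMeasurable (fun ω => (Q ω * C ω) i k) P := fun i k =>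
    ((hF i k).comp_aemeasurable hX).congr (by filter_upwards [hFX] with ω h; simp [h])
  have hind : IndepFun (fun ω (p : Fin n × (Fin n ⊕ Fin n)) => (Q ω * C ω) p.1 p.2)
      (fun ω => Sum.elim (s₁ ω) (s₂ ω)) P := by
    refine (hindep.comp (φ := fun x (p : Fin n × (Fin n ⊕ Fin n)) => F x p.1 p.2)
      (measurable_pi_lambda _ fun p => hF p.1 p.2) measurable_id).congr ?_ .rfl
    filter_upwards [hFX] with ω h
    simp only [Function.comp_apply, ← h, X]
  obtain ⟨hSint, hS⟩ := integrable_and_integral_trace_mul_vecMulVec hmeas hs hind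
    (by simpa only [hCC] using hQint)
  refine ⟨fun A₁ A₂ U' V' Q' α' β' h =>
    ⟨h.isUnit_det_gram hmn, h.mul_conjTranspose_eq_inv_gram hmn⟩, ?_, hQint, hWint, ?_,
    (integral_congr_ae hQW).symm, ?_⟩
  · simpa only [hsymb] using hSint
  · simpa only [powerNormSq, hsymb, hCC] using hS
  · rw [hW]
    congr 1
    have hn0 : (n : ℝ) ≠ 0 := by positivity
    simp only [Fintype.card_sum, Fintype.card_fin, Nat.cast_add]
    have e : 2 * ((m : ℝ) / n) - 1 = ((m + m : ℝ) - n) / n := by field_simp; ring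
    rw [e, one_div_div]
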